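/- Conventions. In a poset $\mathbb P$, $q\le p$ means that $q$ extends $p$; $p,q$ are incompatible ($p\perp q$) if they have no common extension. $\mathbb P$ is separative if for all $p,q\in\mathbb P$ with $q\not\le p$ there is $r\le q$ with $r\perp p$. The Souslin number $S(\mathbb P)$ is the least cardinal $\kappa$ such that every set of pairwise incompatible elements of $\mathbb P$ has size $<\kappa$. A set $\mathbb D\subseteq\mathbb P$ is dense if every element of $\mathbb P$ has an extension in $\mathbb D$. The Noetherian type $Nt(\mathbb D)$ is the least cardinal $\kappa$ such that $|\{p\in\mathbb D : q\le p\}|<\kappa$ for all $q\in\mathbb P$, and $\pi Nt(\mathbb P)=\min\{Nt(\mathbb D):\mathbb D\text{ dense in }\mathbb P\}$. $\bigtriangledown(\mathbb P)$ is the statement $\pi Nt(\mathbb P)\le S(\mathbb P)$, and $\bigtriangledown$ is the statement that $\bigtriangledown(\mathbb P)$ holds for every separative poset $\mathbb P$. For a regular cardinal $\theta$, $H_\theta$ is the set of all sets hereditarily of size $<\theta$; $M\prec H_\theta$ means that $(M,\in)$ is an elementary submodel of $(H_\theta,\in)$; $M$ is ${<}\kappa$-closed if $M^{<\kappa}\subseteq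 M$. For infinite cardinals $\kappa,\mu$ and a set $p$, a $\kappa$-high Davies tree for $\mu$ over $p$ is a sequence $\langle M_\alpha:\alpha<\mu\rangle$ of elementary submodels of $H_\theta$, for some regular $\theta>\kappa,\mu$, such that (1) for all $\alpha<\mu$: $p\in M_\alpha$, $M_\alpha$ is ${<}\kappa$-closed, and $|M_\alpha|=\kappa$; (2) $[\mu]^{<\kappa}\subseteq\bigcup_{\alpha<\mu}M_\alpha$; (3) for each $\alpha<\mu$ there is a set $\mathcal N_\alpha$ of elementary submodels of $H_\theta$ with $|\mathcal N_\alpha|<\kappa$, such that each $N\in\mathcal N_\alpha$ is ${<}\kappa$-closed and contains $p$, and $\bigcup_{\xi<\alpha}M_\xi=\bigcup\mathcal N_\alpha$. Theorem. (i) Let $\mathbb P$ be a separative poset with $S(\mathbb P)=\kappa$. If for some $\mu\ge|\mathbb P|$ there is a $\kappa$-high Davies tree for $\mu$ over $\mathbb P$ (where the elements of $\mathbb P$ are taken to be ordinals $<\mu$, that is, $\mathbb P$ is replaced by some isomorphic copy of this kind, viewed as the pair consisting of its underlying set and its order relation), then $\bigtriangledown(\mathbb P)$ holds. (ii) If for every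 set $p$ and every regular (infinite) cardinal $\kappa$ there are arbitrarily large $\mu$ for which there is a $\kappa$-high Davies tree for $\mu$ over $p$, then $\bigtriangledown$ holds. -/

import Mathlib

universe u

namespace HighDavies

open Cardinal

/-! ### Posets: `q ≤ p` means that `q` extends `p` -/

section Posets

variable (P : Type u) [PartialOrder P]

/-- `p` and `q` have no common extension. -/
def Incompatible {P : Type u} [PartialOrder P] (p q : P) : Prop :=
  ¬ ∃ s : P, s ≤ p ∧ s ≤ q

/-- `P` is separative: if `q ≰ p`, then some `r ≤ q` is incompatible with `p`. -/
def Separative : Prop :=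
  ∀ p q : P, ¬ q ≤ p → ∃ r : P, r ≤ q ∧ Incompatible r p

/-- The `κ`-chain condition: each set of pairwise incompatible elements has size `< κ`. -/
def ChainCondition (κ : Cardinal.{u}) : Prop :=
  ∀ A : Set P, A.Pairwise Incompatible → #A < κ

/-- The Souslin number `S(P) = min {κ : P has the κ-cc}`. -/
noncomputable def souslinNumber : Cardinal.{u} :=
  sInf {κ : Cardinal.{u} | ChainCondition P κ}

/-- `D` is dense in `P`: every element of `P` has an extension in `D`. -/
def DenseIn {P : Type u} [PartialOrder P] (D : Set P) : Prop :=
  ∀ p : P, ∃ q ∈ D, q ≤ p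

/-- The Noetherian type of `D ⊆ P`: the least `κ` such that every `q` in `P` extends
fewer than `κ` elements of `D`. -/
noncomputable def noetherianType {P : Type u} [PartialOrder P] (D : Set P) : Cardinal.{u} :=
  sInf {κ : Cardinal.{u} | ∀ q : P, #{p : P | p ∈ D ∧ q ≤ p} < κ}

/-- The `π`-Noetherian type of `P`: the least Noetherian type of a dense subset of `P`. -/
noncomputable def piNoetherianType : Cardinal.{u} :=
  sInf {ν : Cardinal.{u} | ∃ D : Set P, DenseIn D ∧ noetherianType D = ν}

/-- The statement `▽(P)`. -/
def Triangle : Prop :=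
  piNoetherianType P ≤ souslinNumber P

end Posets

/-! ### Elementary submodels of `(H_θ, ∈)` -/

/-- The only symbol of the language of set theory: the binary relation symbol `∈`. -/
inductive MemRel : ℕ → Type
  | mem : MemRel 2

/-- The first-order language of set theory. -/
def memLanguage : FirstOrder.Language.{0, 0} :=
  ⟨fun _ => Empty, MemRel⟩

/-- Every class `A` of sets is a structure `(A, ∈)`. -/
instance memStructure (A : Set ZFSet.{u}) : memLanguage.Structure A where
  funMap f := f.elim
  RelMap r x :=
    match r, x with
    | MemRel.mem, x => (x 0 : ZFSet.{u}) ∈ (x 1 : ZFSet.{u})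

/-- `M ≺ N`: `M ⊆ N`, and the inclusion of `(M, ∈)` in `(N, ∈)` is an elementary embedding. -/
def ElementarySubmodel (M N : Set ZFSet.{u}) : Prop :=
  ∃ f : FirstOrder.Language.ElementaryEmbedding memLanguage M N,
    ∀ x : M, ((f x : N) : ZFSet.{u}) = x

/-- `H_θ`: all sets that are hereditarily of size `< θ`. -/
def hSet (θ : Cardinal.{u}) : Set ZFSet.{u} :=
  {x | x.Hereditarily fun y => y.card < θ}

/-- `M` is `<κ`-closed: each function from an ordinal `a < κ` to `M` is an element of `M`. -/
def LTClosed (κ : Cardinal.{u}) (M : ZFSet.{u}) : Prop :=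
  ∀ a < κ.ord, ∀ f : ZFSet.{u}, ZFSet.IsFunc a.toZFSet M f → f ∈ M

/-! ### Higher Davies trees -/

/-- `(M α : α < μ)` is a `κ`-high Davies tree for `μ` over `p`, consisting of elementary
submodels of `H_θ`. Values of `M` outside of `μ` play no role. -/
structure IsHighDaviesTree (κ μ : Cardinal.{u}) (p : ZFSet.{u}) (θ : Cardinal.{u})
    (M : Ordinal.{u} → ZFSet.{u}) : Prop where
  aleph0_le_left : ℵ₀ ≤ κ
  aleph0_le_right : ℵ₀ ≤ μ
  /-- `θ` is a regular cardinal, big enough for `κ` and `μ` to be elements of `H_θ`. -/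
  regular : θ.IsRegular
  left_lt : κ < θ
  right_lt : μ < θ
  elementary : ∀ α < μ.ord, ElementarySubmodel (M α : Set ZFSet.{u}) (hSet θ)
  param_mem : ∀ α < μ.ord, p ∈ M α
  closed : ∀ α < μ.ord, LTClosed κ (M α)
  card_eq : ∀ α < μ.ord, (M α).card = κ
  covering : ∀ a : ZFSet.{u}, a ⊆ μ.ord.toZFSet → a.card < κ → ∃ α < μ.ord, a ∈ M α
  coherence : ∀ α < μ.ord, ∃ 𝒩 : ZFSet.{u}, 𝒩.card < κ ∧
    (∀ N ∈ 𝒩, ElementarySubmodel (N : Set ZFSet.{u}) (hSet θ) ∧ LTClosed κ N ∧ p ∈ N) ∧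
    ∀ x : ZFSet.{u}, (∃ ξ < α, x ∈ M ξ) ↔ x ∈ (ZFSet.sUnion 𝒩 : ZFSet.{u})

/-- There is a `κ`-high Davies tree for `μ` over `p`. -/
def HasHighDaviesTree (κ μ : Cardinal.{u}) (p : ZFSet.{u}) : Prop :=
  ∃ (θ : Cardinal.{u}) (M : Ordinal.{u} → ZFSet.{u}), IsHighDaviesTree κ μ p θ M

/-- The set `(A, {(a, b) ∈ A × A : a ≤ b})` that represents the poset `P` when its elements
are identified, through `e`, with the von Neumann ordinals in the range `A` of `e`. -/
noncomputable def posetSet {P : Type u} [PartialOrder P] (e : P → Ordinal.{u}) : ZFSet.{u} :=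
  ZFSet.pair (ZFSet.range fun x : P => (e x).toZFSet)
    (ZFSet.range fun z : {z : P × P // z.1 ≤ z.2} =>
      ZFSet.pair (e z.1.1).toZFSet (e z.1.2).toZFSet)

end HighDavies

/-! Order `P` first by the least stage `α` at which (the code of) an element enters `M α`, then by
its index in an enumeration of `M α` in type `κ`. The elements that none of their extensions precede
form a dense set `D`. A `p` in `D` with `q ≤ p` comes no later than `q`. Fewer than `κ` such `p`
share the stage of `q`. The others lie in one of the fewer than `κ` models `N` that cover the
earlier stages; there `exists_reduction` replaces `q` by some `r` in `N` that extends every element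
of `N` extended by `q`. As `r` has an earlier stage, induction bounds the number of `p` in `N`, and
regularity of `κ` bounds the union.

For the reduction, take a maximal antichain of elements of `N` incompatible with `q`. It has size `<
κ`, so closure makes it available in `N`; elementarity gives an `r` in `N` incompatible with all of
it, and separativity inside `N` shows that this `r` works.

An infinite Souslin number is regular by Erdős–Tarski (`isRegular_souslinNumber`). If it is finite,
the minimal elements are dense and no models are needed. -/

namespace HighDavies

open Cardinal FirstOrder

/-! ### Definability over transitive classes and the Tarski–Vaught property -/

section Elementarity

/-- A relation on a class `H` of sets is definable in `(H, ∈)` without parameters. -/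
def FODefinable (H : Set ZFSet.{u}) {α : Type} (S : (α → H) → Prop) : Prop :=
  ∃ φ : memLanguage.Formula α, ∀ v, φ.Realize v ↔ S v

/-- The symbol `∈` of the language of set theory. -/
def memSymbol : memLanguage.Relations 2 := MemRel.mem

/-- Existential quantification over the last variable. -/
noncomputable def exFormula {α : Type} (φ : memLanguage.Formula (Option α)) :
    memLanguage.Formula α :=
  Language.Formula.iExs Unit
    (φ.relabel fun o : Option α => (o.elim (Sum.inr ()) Sum.inl : α ⊕ Unit))

theorem realize_exFormula {α : Type} (M : Set ZFSet.{u}) (φ : memLanguage.Formula (Option α))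
    (v : α → M) :
    (exFormula φ).Realize v ↔ ∃ x : M, φ.Realize fun o : Option α => o.elim x v := by
  have key : ∀ i : Unit → M, (Sum.elim v i ∘ fun o : Option α =>
      (o.elim (Sum.inr ()) Sum.inl : α ⊕ Unit)) = fun o : Option α => o.elim (i ()) v := by
    intro i
    funext o
    cases o <;> rfl
  rw [exFormula, Language.Formula.realize_iExs]
  simp only [Language.Formula.realize_relabel, key]
  exact ⟨fun ⟨i, hi⟩ => ⟨i (), hi⟩, fun ⟨x, hx⟩ => ⟨fun _ => x, hx⟩⟩

namespace FODefinable

variable {H : Set ZFSet.{u}} {α : Type}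

theorem congr {S T : (α → H) → Prop} (hS : FODefinable H S) (h : ∀ v, S v ↔ T v) :
    FODefinable H T := by
  obtain ⟨φ, hφ⟩ := hS
  exact ⟨φ, fun v => (hφ v).trans (h v)⟩

theorem mem (i j : α) : FODefinable H fun v => (v i : ZFSet) ∈ (v j : ZFSet) := by
  refine ⟨Language.Relations.formula₂ memSymbol
    (Language.Term.var i) (Language.Term.var j), fun v => ?_⟩
  rw [Language.Formula.realize_rel₂]
  rfl

theorem eq (i j : α) : FODefinable H fun v => (v i : ZFSet) = (v j : ZFSet) := by
  refine ⟨Language.Term.equal (Language.Term.var i) (Language.Term.var j), fun v => ?_⟩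
  rw [Language.Formula.realize_equal]
  exact Subtype.ext_iff

theorem not {S : (α → H) → Prop} (hS : FODefinable H S) : FODefinable H fun v => ¬ S v := by
  obtain ⟨φ, hφ⟩ := hS
  refine ⟨φ.not, fun v => ?_⟩
  rw [Language.Formula.realize_not, hφ]

theorem and {S T : (α → H) → Prop} (hS : FODefinable H S) (hT : FODefinable H T) :
    FODefinable H fun v => S v ∧ T v := by
  obtain ⟨φ, hφ⟩ := hS
  obtain ⟨ψ, hψ⟩ := hT
  refine ⟨φ ⊓ ψ, fun v => ?_⟩
  rw [Language.Formula.realize_inf, hφ, hψ]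

theorem ex {S : (Option α → H) → Prop} (hS : FODefinable H S) :
    FODefinable H fun v : α → H => ∃ x : H, S fun o => o.elim x v := by
  obtain ⟨φ, hφ⟩ := hS
  refine ⟨exFormula φ, fun v => ?_⟩
  simp only [realize_exFormula, hφ]

theorem or {S T : (α → H) → Prop} (hS : FODefinable H S) (hT : FODefinable H T) :
    FODefinable H fun v => S v ∨ T v :=
  (hS.not.and hT.not).not.congr fun v => by tauto

theorem iff {S T : (α → H) → Prop} (hS : FODefinable H S) (hT : FODefinable H T) :
    FODefinable H fun v => (S v ↔ T v) :=
  ((hS.and hT).or (hS.not.and hT.not)).congr fun v => by tauto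

theorem all {S : (Option α → H) → Prop} (hS : FODefinable H S) :
    FODefinable H fun v : α → H => ∀ x : H, S fun o => o.elim x v :=
  hS.not.ex.not.congr fun v => by push Not; rfl

/-- The class `H` is transitive. -/
abbrev TransitiveClass (H : Set ZFSet.{u}) : Prop := ∀ ⦃x y : ZFSet.{u}⦄, x ∈ y → y ∈ H → x ∈ H

/-- Quantifiers range over `H` only; transitivity puts every member of `v i` in `H`, so
extensionality can be tested there. -/
theorem doubleton (hH : TransitiveClass H) (i j k : α) :
    FODefinable H fun v => (v i : ZFSet) = {(v j : ZFSet), (v k : ZFSet)} := by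
  refine ((mem none (some i)).iff ((eq none (some j)).or (eq none (some k)))).all.congr fun v => ?_
  simp only [Option.elim]
  constructor
  · intro h
    ext z
    rw [ZFSet.mem_pair]
    constructor
    · intro hz
      exact (h ⟨z, hH hz (v i).2⟩).1 hz
    · rintro (rfl | rfl)
      · exact (h (v j)).2 (Or.inl rfl)
      · exact (h (v k)).2 (Or.inr rfl)
  · intro h x
    rw [h, ZFSet.mem_pair]

theorem pair (hH : TransitiveClass H) (i j k : α) :
    FODefinable H fun v => (v i : ZFSet) = ZFSet.pair (v j) (v k) := by
  refine ((doubleton hH (some none) (some (some j)) (some (some j))).and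
    ((doubleton hH none (some (some j)) (some (some k))).and
      (doubleton hH (some (some i)) (some none) none))).ex.ex.congr fun v => ?_
  simp only [Option.elim]
  constructor
  · rintro ⟨a, b, ha, hb, h⟩
    rw [h, ha, hb, ZFSet.pair]
    simp
  · intro h
    have h1 : ({(v j : ZFSet)} : ZFSet) ∈ H := hH (by rw [h, ZFSet.pair]; simp) (v i).2
    have h2 : ({(v j : ZFSet), (v k : ZFSet)} : ZFSet) ∈ H :=
      hH (by rw [h, ZFSet.pair]; simp) (v i).2
    exact ⟨⟨_, h1⟩, ⟨_, h2⟩, by simp, rfl, h⟩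

theorem pair_mem (hH : TransitiveClass H) (i j k : α) :
    FODefinable H fun v => ZFSet.pair (v j) (v k) ∈ (v i : ZFSet) := by
  refine ((mem none (some i)).and (pair hH none (some j) (some k))).ex.congr fun v => ?_
  simp only [Option.elim]
  exact ⟨fun ⟨x, hx, h⟩ => h ▸ hx, fun h => ⟨⟨_, hH h (v i).2⟩, h, rfl⟩⟩

end FODefinable

open FODefinable

theorem ElementarySubmodel.subset {M N : Set ZFSet.{u}} (h : ElementarySubmodel M N) : M ⊆ N := by
  obtain ⟨f, hf⟩ := h
  intro x hx
  have := (f ⟨x, hx⟩).2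
  rwa [hf] at this

/-- The Tarski–Vaught property. -/
theorem ElementarySubmodel.exists_mem {N H : Set ZFSet.{u}} (h : ElementarySubmodel N H)
    {α : Type} {S : (Option α → H) → Prop} (hS : FODefinable H S) (v : α → H)
    (hv : ∀ i, (v i : ZFSet) ∈ N) (hx : ∃ x : H, S fun o => o.elim x v) :
    ∃ x : H, (x : ZFSet) ∈ N ∧ S fun o => o.elim x v := by
  obtain ⟨f, hf⟩ := h
  obtain ⟨φ, hφ⟩ := hS
  have hfu : (f ∘ fun i => (⟨v i, hv i⟩ : N)) = v := by
    funext i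
    exact Subtype.ext (hf _)
  have h1 : (exFormula φ).Realize v := by
    rw [realize_exFormula]
    simpa only [hφ] using hx
  rw [← hfu, f.map_formula, realize_exFormula] at h1
  obtain ⟨x, h2⟩ := h1
  rw [← f.map_formula, hφ] at h2
  refine ⟨f x, by rw [hf]; exact x.2, ?_⟩
  convert h2 using 1
  funext o
  cases o
  · rfl
  · exact (congrFun hfu _).symm

theorem transitiveClass_hSet (θ : Cardinal.{u}) : TransitiveClass (hSet θ) :=
  fun _ _ hxy hy => ZFSet.Hereditarily.mem hy hxy

theorem ElementarySubmodel.mem_of_singleton_mem {N H : Set ZFSet.{u}}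
    (h : ElementarySubmodel N H) (hH : TransitiveClass H) {x : ZFSet.{u}}
    (hx : ({x} : ZFSet) ∈ N) : x ∈ N := by
  have hxH := h.subset hx
  obtain ⟨y, hy, hyx⟩ := h.exists_mem (FODefinable.mem none (some ()))
    (fun _ : Unit => ⟨{x}, hxH⟩) (fun _ => hx) ⟨⟨x, hH (by simp) hxH⟩, by simp⟩
  simp only [Option.elim, ZFSet.mem_singleton] at hyx
  rwa [← hyx]

theorem ElementarySubmodel.snd_mem_of_pair_mem {N H : Set ZFSet.{u}}
    (h : ElementarySubmodel N H) (hH : TransitiveClass H) {a b : ZFSet.{u}}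
    (hab : ZFSet.pair a b ∈ N) : b ∈ N := by
  have habH := h.subset hab
  have hm : ({a, b} : ZFSet) ∈ H := hH (by simp [ZFSet.pair]) habH
  obtain ⟨y, hy, z, hyz⟩ := h.exists_mem
    (FODefinable.pair hH (some (some ())) none (some none)).ex
    (fun _ : Unit => ⟨ZFSet.pair a b, habH⟩) (fun _ => hab)
    ⟨⟨b, hH (by simp) hm⟩, ⟨a, hH (by simp) hm⟩, rfl⟩
  simp only [Option.elim, ZFSet.pair_inj] at hyz
  rwa [hyz.2]

end Elementarity

end HighDavies

namespace HighDavies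

open Cardinal FirstOrder

/-! ### Reductions to `<κ`-closed elementary submodels -/

section Reduction

variable {P : Type u} [PartialOrder P]

theorem Incompatible.mono {p q p' q' : P} (h : Incompatible p q) (hp : p' ≤ p) (hq : q' ≤ q) :
    Incompatible p' q' :=
  fun ⟨s, h1, h2⟩ => h ⟨s, h1.trans hp, h2.trans hq⟩

theorem Incompatible.symm {p q : P} (h : Incompatible p q) : Incompatible q p :=
  fun ⟨s, h1, h2⟩ => h ⟨s, h2, h1⟩

theorem Incompatible.ne {p q : P} (h : Incompatible p q) : p ≠ q := by
  rintro rfl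
  exact h ⟨p, le_rfl, le_rfl⟩

/-- The set that represents the order relation of `P`. -/
noncomputable def relSet (e : P → Ordinal.{u}) : ZFSet.{u} :=
  ZFSet.range fun z : {z : P × P // z.1 ≤ z.2} =>
    ZFSet.pair (e z.1.1).toZFSet (e z.1.2).toZFSet

variable {e : P → Ordinal.{u}}

theorem pair_mem_relSet_iff {a b : ZFSet.{u}} :
    ZFSet.pair a b ∈ relSet e ↔
      ∃ x y : P, x ≤ y ∧ (e x).toZFSet = a ∧ (e y).toZFSet = b := by
  simp only [relSet, ZFSet.mem_range, ZFSet.pair_inj, Subtype.exists, Prod.exists]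
  constructor
  · rintro ⟨x, y, h, h1, h2⟩
    exact ⟨x, y, h, h1, h2⟩
  · rintro ⟨x, y, h, h1, h2⟩
    exact ⟨x, y, h, h1, h2⟩

theorem pair_mem_relSet (he : Function.Injective e) {x y : P} :
    ZFSet.pair (e x).toZFSet (e y).toZFSet ∈ relSet e ↔ x ≤ y := by
  rw [pair_mem_relSet_iff]
  constructor
  · rintro ⟨x', y', h, h1, h2⟩
    rwa [he (Ordinal.toZFSet_injective h1), he (Ordinal.toZFSet_injective h2)] at h
  · exact fun h => ⟨x, y, h, rfl, rfl⟩

variable {H : Set ZFSet.{u}} {N : ZFSet.{u}} {κ : Cardinal.{u}}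

theorem code_mem (hH : FODefinable.TransitiveClass H) (hR : relSet e ∈ H) (x : P) :
    (e x).toZFSet ∈ H := by
  have h1 : ZFSet.pair (e x).toZFSet (e x).toZFSet ∈ relSet e :=
    pair_mem_relSet_iff.2 ⟨x, x, le_rfl, rfl, rfl⟩
  have h2 : ({(e x).toZFSet} : ZFSet) ∈ H := hH (by simp [ZFSet.pair]) (hH h1 hR)
  exact hH (by simp) h2

/-- Compatibility is absolute for `H`: all codes lie in `H`, and only codes occur in `relSet e`. -/
theorem exists_le_iff_of_relSet (he : Function.Injective e) (hH : FODefinable.TransitiveClass H)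
    (hR : relSet e ∈ H) {x y : P} :
    (∃ z : H, ZFSet.pair z (e x).toZFSet ∈ relSet e ∧ ZFSet.pair z (e y).toZFSet ∈ relSet e) ↔
      ¬ Incompatible x y := by
  rw [Incompatible, not_not]
  constructor
  · rintro ⟨z, h1, h2⟩
    obtain ⟨s, _, _, hs, _⟩ := pair_mem_relSet_iff.1 h1
    rw [← hs, pair_mem_relSet he] at h1 h2
    exact ⟨s, h1, h2⟩
  · rintro ⟨s, h1, h2⟩
    exact ⟨⟨_, code_mem hH hR s⟩, (pair_mem_relSet he).2 h1, (pair_mem_relSet he).2 h2⟩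

/-- Separativity is reflected by elementary submodels. -/
theorem ElementarySubmodel.exists_incompatible (hP : Separative P) (he : Function.Injective e)
    (hH : FODefinable.TransitiveClass H) (hN : ElementarySubmodel (N : Set ZFSet.{u}) H)
    (hR : relSet e ∈ N) {r p : P} (hr : (e r).toZFSet ∈ N) (hp : (e p).toZFSet ∈ N)
    (hrp : ¬ r ≤ p) : ∃ s : P, (e s).toZFSet ∈ N ∧ s ≤ r ∧ Incompatible s p := by
  have hRH := hN.subset hR
  -- Parameters `0, 1, 2` are the order and the codes of `r` and `p`; `none` is the innermost bound
  -- variable, and each enclosing quantifier adds a `some`.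
  obtain ⟨x, hx, h1, h2⟩ := hN.exists_mem
    (((FODefinable.pair_mem hH (some 0) none (some 1)).and
      ((FODefinable.pair_mem hH (some (some 0)) none (some none)).and
        (FODefinable.pair_mem hH (some (some 0)) none (some (some 2)))).ex.not))
    (![⟨relSet e, hRH⟩, ⟨_, hN.subset hr⟩, ⟨_, hN.subset hp⟩] : Fin 3 → H)
    (by intro i; fin_cases i; exacts [hR, hr, hp])
    (by
      obtain ⟨s, hs, hsp⟩ := hP p r hrp
      exact ⟨⟨_, code_mem hH hRH s⟩, (pair_mem_relSet he).2 hs,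
        fun h => (exists_le_iff_of_relSet he hH hRH).1 h hsp⟩)
  obtain ⟨s, _, _, hs, _⟩ := pair_mem_relSet_iff.1 h1
  refine ⟨s, hs ▸ hx, ?_, ?_⟩
  · rw [← pair_mem_relSet he, hs]
    exact h1
  · by_contra hsp
    rw [← exists_le_iff_of_relSet he hH hRH, hs] at hsp
    exact h2 hsp

/-- Small sets of codes are enumerated by elements of `<κ`-closed sets. -/
theorem LTClosed.exists_enumeration {ι : Type u} {e : ι → Ordinal.{u}} (hcl : LTClosed κ N)
    {A : Set ι}
    (hA : ∀ x ∈ A, (e x).toZFSet ∈ N) (hAκ : #A < κ) :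
    ∃ f ∈ N, ∀ y : ZFSet.{u}, (∃ b, ZFSet.pair b y ∈ f) ↔ ∃ x ∈ A, (e x).toZFSet = y := by
  obtain ⟨g⟩ := Cardinal.eq.1 (Cardinal.mk_ord_toType #A).symm
  set o : A → Ordinal.{u} := fun x => ((g x).toOrd : Ordinal.{u}) with ho
  -- Closure concerns functions on ordinals, so `A` enters `N` as the range of an enumeration of
  -- length `(#A).ord`.
  set f : ZFSet.{u} := ZFSet.range fun x : A => ZFSet.pair (o x).toZFSet (e x).toZFSet with hf
  have ho_inj : Function.Injective o := fun x y hxy =>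
    g.injective (Ordinal.ToType.mk.symm.injective (Subtype.ext hxy))
  have ho_lt : ∀ x, o x < (#A).ord := fun x => (g x).toOrd.2
  refine ⟨f, hcl (#A).ord (Cardinal.ord_lt_ord.2 hAκ) f ⟨?_, ?_⟩, fun y => ?_⟩
  · intro z hz
    obtain ⟨x, rfl⟩ := ZFSet.mem_range.1 hz
    exact ZFSet.pair_mem_prod.2
      ⟨Ordinal.toZFSet_mem_toZFSet_iff.2 (ho_lt x), hA x x.2⟩
  · intro z hz
    obtain ⟨a, ha, rfl⟩ := Ordinal.mem_toZFSet_iff.1 hz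
    have hx : o (g.symm (Ordinal.ToType.mk ⟨a, ha⟩)) = a := by simp [ho]
    refine ⟨(e (g.symm (Ordinal.ToType.mk ⟨a, ha⟩))).toZFSet,
      ZFSet.mem_range.2 ⟨g.symm (Ordinal.ToType.mk ⟨a, ha⟩), by rw [hx]⟩, fun w hw => ?_⟩
    obtain ⟨x, hxw⟩ := ZFSet.mem_range.1 hw
    obtain ⟨h1, h2⟩ := ZFSet.pair_inj.1 hxw
    rw [← h2, ho_inj ((Ordinal.toZFSet_injective h1).trans hx.symm)]
  · constructor
    · rintro ⟨b, hb⟩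
      obtain ⟨x, hx⟩ := ZFSet.mem_range.1 hb
      exact ⟨x, x.2, (ZFSet.pair_inj.1 hx).2⟩
    · rintro ⟨x, hx, rfl⟩
      exact ⟨_, ZFSet.mem_range.2 ⟨⟨x, hx⟩, rfl⟩⟩

/-- Small sets of codes in a `<κ`-closed elementary submodel that are not predense have a
witness for this in the submodel. -/
theorem ElementarySubmodel.exists_forall_incompatible (he : Function.Injective e)
    (hH : FODefinable.TransitiveClass H) (hN : ElementarySubmodel (N : Set ZFSet.{u}) H)
    (hcl : LTClosed κ N) (hR : relSet e ∈ N) {A : Set P}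
    (hA : ∀ x ∈ A, (e x).toZFSet ∈ N) (hAκ : #A < κ)
    {q : P} (hq : ∀ x ∈ A, Incompatible q x) :
    ∃ r : P, (e r).toZFSet ∈ N ∧ ∀ x ∈ A, Incompatible r x := by
  have hRH := hN.subset hR
  obtain ⟨f, hfN, hf⟩ := hcl.exists_enumeration hA hAκ
  have hfH := hN.subset hfN
  have hpred : ∀ r : P,
      (¬ ∃ y : H, (∃ b : H, ZFSet.pair b y ∈ f) ∧ ∃ z : H,
        ZFSet.pair z (e r).toZFSet ∈ relSet e ∧ ZFSet.pair z y ∈ relSet e) ↔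
      ∀ x ∈ A, Incompatible r x := by
    intro r
    constructor
    · intro h x hx
      by_contra hrx
      obtain ⟨b, hb⟩ := (hf _).2 ⟨x, hx, rfl⟩
      have hbH : ({b} : ZFSet) ∈ H := hH (by simp [ZFSet.pair]) (hH hb hfH)
      exact h ⟨⟨_, code_mem hH hRH x⟩, ⟨⟨b, hH (by simp) hbH⟩, hb⟩,
        (exists_le_iff_of_relSet he hH hRH).2 hrx⟩
    · rintro h ⟨y, ⟨b, hb⟩, hz⟩
      obtain ⟨x, hx, hxy⟩ := (hf y).1 ⟨b, hb⟩
      rw [← hxy, exists_le_iff_of_relSet he hH hRH] at hz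
      exact hz (h x hx)
  obtain ⟨x, hx, h1, h2⟩ := hN.exists_mem
    ((FODefinable.pair_mem hH (some 0) none none).and
      ((FODefinable.pair_mem hH (some (some (some 1))) none (some none)).ex.and
        ((FODefinable.pair_mem hH (some (some (some 0))) none (some (some none))).and
          (FODefinable.pair_mem hH (some (some (some 0))) none (some none))).ex).ex.not)
    (![⟨relSet e, hRH⟩, ⟨f, hfH⟩] : Fin 2 → H)
    (by intro i; fin_cases i; exacts [hR, hfN])
    ⟨⟨_, code_mem hH hRH q⟩, (pair_mem_relSet he).2 le_rfl, (hpred q).2 hq⟩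
  obtain ⟨r, _, _, hr, _⟩ := pair_mem_relSet_iff.1 h1
  refine ⟨r, hr ▸ hx, (hpred r).1 ?_⟩
  rw [hr]
  exact h2

/-- Every `q` has a reduction `r` to a `<κ`-closed elementary submodel: `r` extends all elements
of the submodel that `q` extends. -/
theorem ElementarySubmodel.exists_reduction (hP : Separative P) (hcc : ChainCondition P κ)
    (he : Function.Injective e) (hH : FODefinable.TransitiveClass H)
    (hN : ElementarySubmodel (N : Set ZFSet.{u}) H) (hcl : LTClosed κ N)
    (hp : posetSet e ∈ N) (q : P) :
    ∃ r : P, (e r).toZFSet ∈ N ∧ ∀ p : P, (e p).toZFSet ∈ N → q ≤ p → r ≤ p := by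
  have hR : relSet e ∈ N := hN.snd_mem_of_pair_mem hH hp
  obtain ⟨A, hA⟩ := zorn_subset
    {A : Set P | A.Pairwise Incompatible ∧ ∀ x ∈ A, (e x).toZFSet ∈ N ∧ Incompatible q x} (by
      intro c hc hchain
      refine ⟨⋃₀ c, ⟨(Set.pairwise_sUnion hchain.directedOn).2 fun s hs => (hc hs).1, ?_⟩,
        fun s hs => Set.subset_sUnion_of_mem hs⟩
      rintro x ⟨s, hs, hx⟩
      exact (hc hs).2 x hx)
  obtain ⟨r, hr, hrA⟩ := hN.exists_forall_incompatible he hH hcl hR (fun x hx => (hA.1.2 x hx).1)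
    (hcc A hA.1.1) (fun x hx => (hA.1.2 x hx).2)
  refine ⟨r, hr, fun p hpN hqp => ?_⟩
  by_contra hrp
  obtain ⟨s, hs, hsr, hsp⟩ := hN.exists_incompatible hP he hH hR hr hpN hrp
  -- Since `q ≤ p`, `s` is incompatible with `q`; since `s ≤ r`, it is incompatible with all of `A`.
  -- Maximality forces it into `A`.
  have hsA : s ∈ A := by
    refine hA.2 (y := insert s A) ⟨?_, ?_⟩ (Set.subset_insert s A) (Set.mem_insert s A)
    · refine hA.1.1.insert fun x hx _ => ?_
      have := (hrA x hx).mono hsr le_rfl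
      exact ⟨this, this.symm⟩
    · rintro x (rfl | hx)
      · exact ⟨hs, (hsp.mono le_rfl hqp).symm⟩
      · exact hA.1.2 x hx
  exact ((hrA s hsA).mono hsr le_rfl).ne rfl

end Reduction

end HighDavies

namespace HighDavies

open Cardinal

/-! ### Souslin numbers and the finite case -/

section Souslin

variable (P : Type u) [PartialOrder P]

theorem chainCondition_souslinNumber : ChainCondition P (souslinNumber P) :=
  csInf_mem (s := {κ : Cardinal.{u} | ChainCondition P κ})
    ⟨Order.succ #P, fun A _ => Order.lt_succ_of_le (mk_set_le A)⟩

variable {P}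

theorem noetherianType_le {D : Set P} {κ : Cardinal.{u}}
    (h : ∀ q : P, #{p : P | p ∈ D ∧ q ≤ p} < κ) : noetherianType D ≤ κ :=
  csInf_le' h

theorem triangle_of_dense {D : Set P} (hD : DenseIn D)
    (h : ∀ q : P, #{p : P | p ∈ D ∧ q ≤ p} < souslinNumber P) : Triangle P :=
  (csInf_le' ⟨D, hD, rfl⟩ : piNoetherianType P ≤ noetherianType D).trans (noetherianType_le h)

/-- In a separative poset without infinite antichains, every element has a minimal extension. -/
theorem Separative.exists_minimal (hP : Separative P) (hcc : ChainCondition P ℵ₀) (p : P) :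
    ∃ m ≤ p, IsMin m := by
  by_contra! h
  have hstep : ∀ x : Set.Iic p, ∃ y : Set.Iic p, ∃ r : P,
      y ≤ x ∧ r ≤ x ∧ Incompatible r (y : P) := by
    intro x
    have := h x x.2
    rw [not_isMin_iff] at this
    obtain ⟨y, hy⟩ := this
    obtain ⟨r, hr, hry⟩ := hP y x hy.not_ge
    exact ⟨⟨y, hy.le.trans x.2⟩, r, hy.le, hr, hry⟩
  -- Iterating `y` gives a descending sequence; each `r (s n)` lies below `s n` but is incompatible
  -- with `s (n + 1)`, so these elements form an infinite antichain.
  choose y r hyx hrx hry using hstep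
  set s : ℕ → Set.Iic p := fun n => y^[n] ⟨p, le_rfl⟩ with hs
  have hs_succ : ∀ n, s (n + 1) = y (s n) := fun n => Function.iterate_succ_apply' _ _ _
  have hs_anti : Antitone s := antitone_nat_of_succ_le fun n => by
    rw [hs_succ]
    exact hyx _
  have hlt : ∀ m n, m < n → Incompatible (r (s m)) (r (s n)) := by
    intro m n hmn
    refine (hry (s m)).mono le_rfl ((hrx _).trans ?_)
    rw [← hs_succ]
    exact hs_anti hmn
  have hne : ∀ m n, m ≠ n → Incompatible (r (s m)) (r (s n)) := by
    intro m n hmn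
    rcases hmn.lt_or_gt with h | h
    exacts [hlt _ _ h, (hlt _ _ h).symm]
  have hinj : Function.Injective fun n => r (s n) := by
    intro m n hmn
    by_contra h
    exact (hne m n h).ne hmn
  have := hcc (Set.range fun n => r (s n)) (by
    rintro _ ⟨m, rfl⟩ _ ⟨n, rfl⟩ hmn
    exact hne m n (by rintro rfl; exact hmn rfl))
  exact Set.infinite_range_of_injective hinj (lt_aleph0_iff_set_finite.1 this)

theorem Separative.triangle_of_souslinNumber_lt (hP : Separative P)
    (h : souslinNumber P < ℵ₀) : Triangle P := by
  have hcc := chainCondition_souslinNumber P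
  refine triangle_of_dense (D := {m : P | IsMin m}) (fun p => ?_) fun q => ?_
  · obtain ⟨m, hm, hmin⟩ := hP.exists_minimal (fun A hA => (hcc A hA).trans h) p
    exact ⟨m, hmin, hm⟩
  · have h1 := hcc {q} (Set.pairwise_singleton _ _)
    refine lt_of_le_of_lt (mk_le_mk_of_subset ?_) h1
    rintro p ⟨hp, hqp⟩
    exact (le_antisymm (hp hqp) hqp)

end Souslin

end HighDavies

namespace HighDavies

open Cardinal

/-! ### Regularity of infinite Souslin numbers -/

section ErdosTarski

variable {P : Type u} [PartialOrder P]

theorem pairwise_incompatible_iUnion {ι : Type u} {b : ι → P}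
    (hb : ∀ i j, i ≠ j → Incompatible (b i) (b j)) {A : ι → Set P}
    (hAb : ∀ i, A i ⊆ Set.Iic (b i)) (hA : ∀ i, (A i).Pairwise Incompatible) :
    (⋃ i, A i).Pairwise Incompatible := by
  intro x hx y hy hxy
  obtain ⟨i, hi⟩ := Set.mem_iUnion.1 hx
  obtain ⟨j, hj⟩ := Set.mem_iUnion.1 hy
  by_cases hij : i = j
  · subst hij
    exact hA i hi hj hxy
  · exact (hb i j hij).mono (hAb i hi) (hAb j hj)

/-- Some pairwise incompatible set of size at least `c` lies below `p`. -/
def Splits (p : P) (c : Cardinal.{u}) : Prop :=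
  ∃ A ⊆ Set.Iic p, A.Pairwise Incompatible ∧ c ≤ #A

theorem exists_pairwise_of_lt_souslinNumber {c : Cardinal.{u}} (hc : c < souslinNumber P) :
    ∃ A : Set P, A.Pairwise Incompatible ∧ c ≤ #A := by
  have := notMem_of_lt_csInf' hc
  simpa [ChainCondition] using this

theorem exists_cofinal_family_of_isSingular {κ : Cardinal.{u}} (hκ : κ.IsSingular) :
    ∃ (ι : Type u) (f : ι → Cardinal.{u}), #ι < κ ∧ (∀ i, f i < κ) ∧ ∀ c < κ, ∃ i, c ≤ f i := by
  obtain ⟨s, hs, hcard⟩ := Order.exists_cof_eq κ.ord.ToType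
  rw [Ordinal.cof_toType] at hcard
  refine ⟨s, fun i => ((i : κ.ord.ToType).toOrd : Ordinal).card, hcard ▸ hκ.cof_ord_lt,
    fun i => lt_ord.1 (i : κ.ord.ToType).toOrd.2, fun c hc => ?_⟩
  obtain ⟨i, hi, hci⟩ := hs (Ordinal.ToType.mk ⟨c.ord, ord_lt_ord.2 hc⟩)
  refine ⟨⟨i, hi⟩, ?_⟩
  rw [← OrderIso.le_symm_apply] at hci
  have := Ordinal.card_le_card (show c.ord ≤ i.toOrd from hci)
  rwa [card_ord] at this

/-- Otherwise an antichain below `p` indexed by a cofinal family of cardinals can be refined to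
antichains of these sizes. Their union is an antichain whose size is at least every cardinal below
the Souslin number, a limit cardinal. -/
theorem not_forall_splits (hS : (souslinNumber P).IsSingular) (p : P) :
    ∃ q ≤ p, ∃ c < souslinNumber P, ¬ Splits q c := by
  by_contra! h
  obtain ⟨ι, f, hι, hf, hcof⟩ := exists_cofinal_family_of_isSingular hS
  obtain ⟨B, hBp, hB, hιB⟩ := h p le_rfl _ hι
  obtain ⟨j⟩ := hιB
  choose A hA hAp hAc using fun i => h (j i) (hBp (j i).2) (f i) (hf i)
  have hU := chainCondition_souslinNumber P _ (pairwise_incompatible_iUnion (b := fun i => (j i : P))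
    (fun i i' hii' => hB (j i).2 (j i').2 fun h => hii' (j.injective (Subtype.ext h))) hA hAp)
  obtain ⟨i, hi⟩ := hcof _ (hS.isSuccLimit.succ_lt hU)
  have := (hi.trans (hAc i)).trans (mk_le_mk_of_subset (Set.subset_iUnion A i))
  exact (Order.lt_succ _).not_ge this

/-- If densely many elements lie below the pairwise incompatible family `A`, on which
pairwise incompatible sets have size at most `c`, then all of them have size at most `#A * c`. -/
theorem mk_le_mul_of_predense {A : Set P} (hA : ∀ p : P, ∃ a ∈ A, ¬ Incompatible p a)
    {c : Cardinal.{u}}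
    (hc : ∀ a ∈ A, ∀ B ⊆ Set.Iic a, B.Pairwise Incompatible → #B ≤ c)
    {B : Set P} (hB : B.Pairwise Incompatible) : #B ≤ #A * c := by
  have h : ∀ b : B, ∃ (a : A) (d : P), d ≤ b ∧ d ≤ a := by
    intro b
    obtain ⟨a, ha, hab⟩ := hA b
    obtain ⟨d, hd⟩ := not_not.1 hab
    exact ⟨⟨a, ha⟩, d, hd⟩
  choose a d hdb hda using h
  have hdd : ∀ b b' : B, b ≠ b' → Incompatible (d b) (d b') := fun b b' hbb' =>
    (hB b.2 b'.2 fun h => hbb' (Subtype.ext h)).mono (hdb b) (hdb b')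
  have hinj : Function.Injective d := fun b b' hbb' => by
    by_contra h
    exact (hdd b b' h).ne hbb'
  rw [← Cardinal.mk_congr (Equiv.sigmaFiberEquiv a), mk_sigma, ← sum_const']
  refine sum_le_sum _ _ fun x => ?_
  refine le_trans (le_of_eq (mk_image_eq hinj (s := {b | a b = x})).symm) (hc x x.2 _ ?_ ?_)
  · rintro _ ⟨b, rfl, rfl⟩
    exact hda b
  · rintro _ ⟨b, _, rfl⟩ _ ⟨b', _, rfl⟩ hbb'
    exact hdd b b' (by rintro rfl; exact hbb' rfl)

/-- The Erdős–Tarski theorem: infinite Souslin numbers are regular. -/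
theorem isRegular_souslinNumber (h : ℵ₀ ≤ souslinNumber P) : (souslinNumber P).IsRegular := by
  by_contra hreg
  have hS := IsSingular.of_not_isRegular h hreg
  have hcc := chainCondition_souslinNumber P
  obtain ⟨A, hA⟩ := zorn_subset
    {A : Set P | A.Pairwise Incompatible ∧ ∀ x ∈ A, ∃ c < souslinNumber P, ¬ Splits x c} (by
      intro c hc hchain
      refine ⟨⋃₀ c, ⟨(Set.pairwise_sUnion hchain.directedOn).2 fun s hs => (hc hs).1, ?_⟩,
        fun s hs => Set.subset_sUnion_of_mem hs⟩
      rintro x ⟨s, hs, hx⟩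
      exact (hc hs).2 x hx)
  have hpre : ∀ p : P, ∃ a ∈ A, ¬ Incompatible p a := by
    intro p
    by_contra! hp
    obtain ⟨q, hqp, hq⟩ := not_forall_splits hS p
    have hqA : q ∈ A := by
      refine hA.2 (y := insert q A) ⟨hA.1.1.insert fun x hx _ => ?_, ?_⟩ (Set.subset_insert q A)
        (Set.mem_insert q A)
      · have := (hp x hx).mono hqp le_rfl
        exact ⟨this, this.symm⟩
      · rintro x (rfl | hx)
        · exact hq
        · exact hA.1.2 x hx
    exact ((hp q hqA).mono hqp le_rfl).ne rfl
  let s : A → Cardinal.{u} := fun a => sInf {c | ¬ Splits (a : P) c}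
  have hs_lt : ∀ a, s a < souslinNumber P := fun a =>
    let ⟨c, hc, hac⟩ := hA.1.2 a a.2
    (csInf_le' hac).trans_lt hc
  have hs_splits : ∀ a, ∀ c < s a, Splits (a : P) c := fun a c hc =>
    not_not.1 (notMem_of_lt_csInf' hc)
  have hs_bound : ∀ a : A, ∀ B ⊆ Set.Iic (a : P), B.Pairwise Incompatible → #B ≤ s a := by
    intro a B hBa hB
    obtain ⟨c, hc, hac⟩ := hA.1.2 a a.2
    have hmem : ¬ Splits (a : P) (s a) := csInf_mem (s := {c | ¬ Splits (a : P) c}) ⟨c, hac⟩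
    by_contra hlt
    exact hmem ⟨B, hBa, hB, (not_le.1 hlt).le⟩
  -- A common bound `c` for the values of `s` would bound all antichains by `#A * c`, which is below
  -- the Souslin number.
  have hs_cof : ∀ c < souslinNumber P, ∃ a, c < s a := by
    intro c hc
    by_contra! hle
    have hlt : #A * c < souslinNumber P := mul_lt_of_lt h (hcc A hA.1.1) hc
    obtain ⟨B, hB, hBc⟩ := exists_pairwise_of_lt_souslinNumber (hS.isSuccLimit.succ_lt hlt)
    have := mk_le_mul_of_predense hpre
      (fun a ha B hBa hB => (hs_bound ⟨a, ha⟩ B hBa hB).trans (hle _)) hB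
    exact (Order.lt_succ _).not_ge (hBc.trans this)
  -- An antichain of size `s a` need not exist below `a`. It suffices to reach the value of `s`
  -- immediately preceding `s a`, if there is one: as the values are unbounded, each of them
  -- immediately precedes another.
  have hB : ∀ a : A, ∃ B ⊆ Set.Iic (a : P), B.Pairwise Incompatible ∧
      ∀ a', s a' < s a → (∀ x, s x ≤ s a' ∨ s a ≤ s x) → s a' ≤ #B := by
    intro a
    by_cases ha : ∃ a', s a' < s a ∧ ∀ x, s x ≤ s a' ∨ s a ≤ s x
    · obtain ⟨a', hlt, ha'⟩ := ha
      obtain ⟨B, hBa, hB, hc⟩ := hs_splits a _ hlt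
      exact ⟨B, hBa, hB, fun x hx _ => ((ha' x).resolve_right hx.not_ge).trans hc⟩
    · exact ⟨∅, Set.empty_subset _, Set.pairwise_empty _,
        fun a' hlt ha' => (ha ⟨a', hlt, ha'⟩).elim⟩
  choose B hBa hBp hBc using hB
  have hU := hcc _ (pairwise_incompatible_iUnion (b := fun a : A => (a : P))
    (fun a a' haa' => hA.1.1 a.2 a'.2 fun h => haa' (Subtype.ext h)) hBa hBp)
  obtain ⟨a₀, ha₀⟩ := hs_cof _ hU
  have hwf : WellFounded (fun x y : A => s x < s y) := InvImage.wf s wellFounded_lt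
  obtain ⟨a₁, ha₁, hmin⟩ := hwf.has_min {a | s a₀ < s a} (hs_cof _ (hs_lt a₀))
  have := hBc a₁ a₀ ha₁ fun x => by
    by_contra! hx
    exact hmin x hx.1 hx.2
  exact (ha₀.trans_le this).not_ge (mk_le_mk_of_subset (Set.subset_iUnion B a₁))

end ErdosTarski

end HighDavies

namespace HighDavies

open Cardinal

/-! ### The dense set obtained from a Davies tree -/

section DaviesTree

/-- This numbers the elements coded in a model by indices below `κ.ord`; elements outside get an
arbitrary value, hence `κ ≠ 0`. -/
theorem exists_injOn_toType {ι : Type u} {f : ι → ZFSet.{u}} (hf : Function.Injective f)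
    {N : ZFSet.{u}} {κ : Cardinal.{u}} (hκ : κ ≠ 0) (hN : N.card ≤ κ) :
    ∃ g : ι → κ.ord.ToType, Set.InjOn g {x | f x ∈ N} := by
  have h1 : #{x | f x ∈ N} ≤ κ := by
    refine le_trans (mk_le_of_injective (f := fun x : {x | f x ∈ N} =>
      equivShrink N ⟨f x, x.2⟩) fun x y hxy => ?_) hN
    have := (equivShrink N).injective hxy
    exact Subtype.ext (hf (Subtype.ext_iff.1 this))
  rw [← mk_ord_toType κ] at h1 hκ
  obtain ⟨g⟩ := h1
  obtain ⟨z⟩ := mk_ne_zero_iff.1 hκ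
  classical
  refine ⟨fun x => if hx : f x ∈ N then g ⟨x, hx⟩ else z, fun x hx y hy hxy => ?_⟩
  have hx' : f x ∈ N := hx
  have hy' : f y ∈ N := hy
  simp only [hx', hy', dif_pos] at hxy
  exact Subtype.ext_iff.1 (g.injective hxy)

theorem mk_Iic_toType_ord_lt {κ : Cardinal.{u}} (hκ : ℵ₀ ≤ κ) (i : κ.ord.ToType) :
    #(Set.Iic i) < κ := by
  have hlt : #(Set.Iio i) < #κ.ord.ToType := mk_Iio_lt i (by simp)
  rw [mk_ord_toType] at hlt
  rw [← Set.Iio_insert]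
  exact mk_insert_le.trans_lt
    (add_lt_of_lt hκ hlt (one_lt_aleph0.trans_le hκ))

variable {P : Type u} [PartialOrder P] {κ μ θ : Cardinal.{u}} {e : P → Ordinal.{u}}
  {M : Ordinal.{u} → ZFSet.{u}}

theorem IsHighDaviesTree.exists_code_mem (hM : IsHighDaviesTree κ μ (posetSet e) θ M)
    (heμ : ∀ x, e x < μ.ord) (x : P) : ∃ α < μ.ord, (e x).toZFSet ∈ M α := by
  obtain ⟨α, hα, hx⟩ := hM.covering {(e x).toZFSet} (by
      intro z hz
      rw [ZFSet.mem_singleton.1 hz]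
      exact Ordinal.toZFSet_mem_toZFSet_iff.2 (heμ x)) (by
      rw [ZFSet.card_singleton]
      exact one_lt_aleph0.trans_le hM.aleph0_le_left)
  exact ⟨α, hα, (hM.elementary α hα).mem_of_singleton_mem (transitiveClass_hSet θ) hx⟩

theorem IsHighDaviesTree.triangle (hP : Separative P)
    (hM : IsHighDaviesTree (souslinNumber P) μ (posetSet e) θ M)
    (he : Function.Injective e) (heμ : ∀ x, e x < μ.ord) : Triangle P := by
  set κ := souslinNumber P with hκ
  have hreg : κ.IsRegular := isRegular_souslinNumber hM.aleph0_le_left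
  have hcode : Function.Injective fun x : P => (e x).toZFSet :=
    Ordinal.toZFSet_injective.comp he
  have hmem := hM.exists_code_mem heμ
  let rk : P → Ordinal.{u} := fun x => sInf {α | α < μ.ord ∧ (e x).toZFSet ∈ M α}
  have hrk : ∀ x, rk x < μ.ord ∧ (e x).toZFSet ∈ M (rk x) := fun x =>
    csInf_mem (s := {α | α < μ.ord ∧ (e x).toZFSet ∈ M α}) (hmem x)
  have hrk_le : ∀ x, ∀ α < μ.ord, (e x).toZFSet ∈ M α → rk x ≤ α := fun x α hα hx =>
    csInf_le' ⟨hα, hx⟩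
  have hg : ∀ α, ∃ g : P → κ.ord.ToType, α < μ.ord → Set.InjOn g {x | (e x).toZFSet ∈ M α} := by
    intro α
    by_cases hα : α < μ.ord
    · obtain ⟨g, hg⟩ := exists_injOn_toType hcode hreg.ne_zero (hM.card_eq α hα).le
      exact ⟨g, fun _ => hg⟩
    · exact ⟨fun _ => Ordinal.ToType.mk ⟨0, hreg.ord_pos⟩, fun h => (hα h).elim⟩
  choose g hg using hg
  let key : P → Ordinal.{u} ×ₗ κ.ord.ToType := fun x => toLex (rk x, g (rk x) x)
  refine triangle_of_dense (D := {p | ∀ q ≤ p, key p ≤ key q}) (fun p => ?_) fun q => ?_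
  · obtain ⟨m, hm, hmin⟩ := (InvImage.wf key wellFounded_lt).has_min (Set.Iic p) ⟨p, le_rfl⟩
    exact ⟨m, fun q hq => not_lt.1 (hmin q (hq.trans hm)), hm⟩
  -- The induction is on the stage alone: a reduction of `q` drops to an earlier stage, but its
  -- index there is uncontrolled.
  · induction hα : rk q using WellFoundedLT.induction generalizing q with
    | ind α ih =>
    subst hα
    obtain ⟨𝒩, hcard, h𝒩, hunion⟩ := hM.coherence (rk q) (hrk q).1
    have hred : ∀ N ∈ 𝒩, ∃ r : P, (e r).toZFSet ∈ N ∧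
        ∀ p : P, (e p).toZFSet ∈ N → q ≤ p → r ≤ p := fun N hN =>
      (h𝒩 N hN).1.exists_reduction hP (chainCondition_souslinNumber P) he
        (transitiveClass_hSet θ) (h𝒩 N hN).2.1 (h𝒩 N hN).2.2 q
    have hold : ∀ N ∈ 𝒩, ∀ x : P, (e x).toZFSet ∈ N → rk x < rk q := by
      intro N hN x hx
      obtain ⟨ξ, hξ, hxξ⟩ := (hunion _).2 (ZFSet.mem_sUnion.2 ⟨N, hN, hx⟩)
      exact (hrk_le x ξ (hξ.trans (hrk q).1) hxξ).trans_lt hξ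
    choose r hrN hr using hred
    let t : Shrink.{u} 𝒩 → Set P := fun N => let N' := (equivShrink 𝒩).symm N
      {p | (∀ q ≤ p, key p ≤ key q) ∧ r N' N'.2 ≤ p}
    -- `t N` consists of the members of `D` above the reduction of `q` to `N`, so the induction
    -- hypothesis applies to each.
    have ht : #(⋃ N, t N : Set P) < κ := by
      rw [card_iUnion_lt_iff_forall_of_isRegular hreg hcard]
      intro N
      exact ih _ (hold _ ((equivShrink 𝒩).symm N).2 _ (hrN _ _)) _ rfl
    have hsame : #{p : P | rk p = rk q ∧ g (rk q) p ≤ g (rk q) q} < κ := by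
      refine lt_of_le_of_lt (mk_le_of_injective (f := fun p :
        {p : P | rk p = rk q ∧ g (rk q) p ≤ g (rk q) q} =>
          (⟨g (rk q) p, p.2.2⟩ : Set.Iic (g (rk q) q))) fun p p' hpp' => ?_)
        (mk_Iic_toType_ord_lt hreg.aleph0_le (g (rk q) q))
      refine Subtype.ext (hg (rk q) (hrk q).1 ?_ ?_ (Subtype.ext_iff.1 hpp'))
      · have h := (hrk p).2
        rwa [p.2.1] at h
      · have h := (hrk p').2
        rwa [p'.2.1] at h
    refine lt_of_le_of_lt (mk_le_mk_of_subset ?_)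
      ((mk_union_le _ _).trans_lt (add_lt_of_lt hreg.aleph0_le ht hsame))
    rintro p ⟨hpD, hqp⟩
    rcases Prod.Lex.le_iff.1 (hpD q hqp) with hlt | ⟨heq, hle⟩
    · left
      have hlt' : rk p < rk q := hlt
      obtain ⟨N, hN, hpN⟩ := ZFSet.mem_sUnion.1 ((hunion _).1 ⟨rk p, hlt', (hrk p).2⟩)
      refine Set.mem_iUnion.2 ⟨equivShrink 𝒩 ⟨N, hN⟩, hpD, ?_⟩
      simp only [Equiv.symm_apply_apply]
      exact hr N hN p hpN hqp
    · right
      have heq' : rk p = rk q := heq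
      have hle' : g (rk p) p ≤ g (rk q) q := hle
      exact ⟨heq', heq' ▸ hle'⟩

end DaviesTree

end HighDavies

theorem theorem3 :
    (∀ (P : Type u) [PartialOrder P] (κ : Cardinal.{u}),
      HighDavies.Separative P → HighDavies.souslinNumber P = κ →
      (∃ μ : Cardinal.{u}, Cardinal.mk P ≤ μ ∧
        ∃ e : P → Ordinal.{u}, Function.Injective e ∧ (∀ x : P, e x < μ.ord) ∧
          HighDavies.HasHighDaviesTree κ μ (HighDavies.posetSet e)) →
      HighDavies.Triangle P) ∧
    ((∀ (p : ZFSet.{u}) (κ : Cardinal.{u}), κ.IsRegular →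
        ∀ ν : Cardinal.{u}, ∃ μ : Cardinal.{u}, ν ≤ μ ∧ HighDavies.HasHighDaviesTree κ μ p) →
      ∀ (P : Type u) [PartialOrder P], HighDavies.Separative P → HighDavies.Triangle P) := by
  constructor
  · rintro P _ κ hP rfl ⟨μ, -, e, he, heμ, θ, M, hM⟩
    exact hM.triangle hP he heμ
  · intro h P _ hP
    -- Trees are assumed only for regular, hence infinite, cardinals.
    rcases lt_or_ge (HighDavies.souslinNumber P) Cardinal.aleph0 with hS | hS
    · exact hP.triangle_of_souslinNumber_lt hS
    · obtain ⟨g⟩ := Cardinal.eq.1 (Cardinal.mk_ord_toType (Cardinal.mk P)).symm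
      let e : P → Ordinal.{u} := fun x => (g x).toOrd
      have he : Function.Injective e := fun x y hxy =>
        g.injective (Ordinal.ToType.mk.symm.injective (Subtype.ext hxy))
      obtain ⟨μ, hμ, θ, M, hM⟩ := h (HighDavies.posetSet e) (HighDavies.souslinNumber P)
        (HighDavies.isRegular_souslinNumber hS) (Cardinal.mk P)
      exact hM.triangle hP he fun x =>
        lt_of_lt_of_le (g x).toOrd.2 (Cardinal.ord_le_ord.2 hμ)
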